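/- Let $n,d\ge 0$ be integers and $[n]=\{1,\dots,n\}$. Let $\mathbf B=(l_r,u_r)_{r=1}^d$ be a bounding family, i.e. functions $l_r,u_r:[n-1]\to[-\infty,\infty]$ with $l_r(t)<u_r(t)$ for all $r\in[d]$, $t\in[n-1]$ (real-valued bounds are the basic case; monotonicity is $l_r=0$, $u_r=+\infty$). Let $\mathcal P$ be the set of all $f:[n]^d\to\mathbb R$ such that $l_r(x_r)\le f(x+e_r)-f(x)\le u_r(x_r)$ for all $r\in[d]$ and all $x\in[n]^d$ with $x_r<n$. A line along dimension $i$ (an $i$-line) consists of the $n$ points of $[n]^d$ with prescribed coordinates other than the $i$-th; $\mathcal L(n,d)$ denotes the set of all axis-parallel lines (a direction together with the remaining coordinates). For an $i$-line $\ell$, the restriction $f|_\ell$ is viewed as a function on $[n]$, and $\mathcal P_\ell$ is the set of all $h:[n]\to\mathbb R$ with $l_i(t)\le h(t+1)-h(t)\le u_i(t)$ for all $t\in[n-1]$. Put $$L_1(f,\mathcal P)=\inf_{g\in\mathcal P}\sum_{x\in[n]^d}|f(x)-g(x)|,\qquad L_1(f|_\ell,\mathcal P)=\inf_{h\in\mathcal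 P_\ell}\sum_{t\in[n]}|f|_\ell(t)-h(t)|.$$ Then for every $f:[n]^d\to\mathbb R$, $$\sum_{\ell\in\mathcal L(n,d)}L_1(f|_\ell,\mathcal P)\ \ge\ \tfrac12\,L_1(f,\mathcal P).$$ Moreover, the same holds with respect to product distributions: for all probability distributions $\mu_1,\dots,\mu_d$ on $[n]$, $$\sum_{i=1}^d\ \sum_{\ell\ i\text{-line}}\Big(\prod_{j\ne i}\mu_j(\ell_j)\Big)\inf_{h\in\mathcal P_\ell}\sum_{t\in[n]}\mu_i(t)\,|f|_\ell(t)-h(t)|\ \ge\ \tfrac12\inf_{g\in\mathcal P}\sum_{x\in[n]^d}\Big(\prod_{i=1}^d\mu_i(x_i)\Big)|f(x)-g(x)|,$$ where $\ell_j$ is the common $j$-th coordinate of the points of $\ell$. -/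

import Mathlib

/-- The hypergrid `[n]^d`; coordinates run over `Fin n`, i.e. `0, …, n - 1`. -/
abbrev Grid (n d : ℕ) : Type := Fin d → Fin n

/-- A bounding family on `[n]^d`: for every dimension `r` and every edge position `t`
(the edge joining `t` and `t + 1`), a lower and an upper bound with `lower < upper`.
Infinite bounds are allowed, so that e.g. monotonicity (`lower = 0`, `upper = ⊤`) is covered. -/
structure BoundingFamily (n d : ℕ) where
  lower : Fin d → Fin (n - 1) → EReal
  upper : Fin d → Fin (n - 1) → EReal
  lower_lt_upper : ∀ r t, lower r t < upper r t

namespace BoundingFamily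

variable {n d : ℕ}

/-- The bounded-derivative property `P(B)`: all `f : [n]^d → ℝ` whose discrete partial derivative
`∂_r f (x) = f (x + e_r) - f x` lies in `[lower r (x r), upper r (x r)]`, for every dimension `r`
and every point `x` such that `x + e_r` belongs to the grid. -/
def property (B : BoundingFamily n d) : Set (Grid n d → ℝ) :=
  {f | ∀ (r : Fin d) (x : Grid n d) (h : (x r : ℕ) + 1 < n),
    B.lower r ⟨x r, by omega⟩
        ≤ ((f (Function.update x r ⟨(x r : ℕ) + 1, h⟩) - f x : ℝ) : EReal) ∧
    ((f (Function.update x r ⟨(x r : ℕ) + 1, h⟩) - f x : ℝ) : EReal)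
        ≤ B.upper r ⟨x r, by omega⟩}

/-- The property that `P(B)` induces on lines along dimension `r`: all `h : [n] → ℝ` whose
discrete derivative `h (t + 1) - h t` lies in `[lower r t, upper r t]` at every edge. -/
def lineProperty (B : BoundingFamily n d) (r : Fin d) : Set (Fin n → ℝ) :=
  {g | ∀ (t : Fin n) (h : (t : ℕ) + 1 < n),
    B.lower r ⟨t, by omega⟩ ≤ ((g ⟨(t : ℕ) + 1, h⟩ - g t : ℝ) : EReal) ∧
    ((g ⟨(t : ℕ) + 1, h⟩ - g t : ℝ) : EReal) ≤ B.upper r ⟨t, by omega⟩}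

end BoundingFamily

/-- An axis-parallel line of `[n]^d`: its direction `i`, and the values of the other coordinates. -/
abbrev AxisLine (n d : ℕ) : Type := (i : Fin d) × ({j : Fin d // j ≠ i} → Fin n)

namespace AxisLine

variable {n d : ℕ}

/-- The dimension along which the line runs. -/
def dir (l : AxisLine n d) : Fin d := l.1

/-- The point at position `t` on the line. -/
def point (l : AxisLine n d) (t : Fin n) : Grid n d :=
  fun j => if h : j = l.1 then t else l.2 ⟨j, h⟩

/-- The restriction of `f` to the line, as a function on `[n]`. -/
def restrict (l : AxisLine n d) (f : Grid n d → ℝ) : Fin n → ℝ := fun t => f (l.point t)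

/-- The probability of the line among the lines of its direction `i`, under the product
`∏_{j ≠ i} μ j`. -/
def mass (l : AxisLine n d) (μ : Fin d → Fin n → ℝ) : ℝ :=
  ∏ j : {j : Fin d // j ≠ l.1}, μ j.1 (l.2 j)

end AxisLine

/-- The probability of a grid point under the product distribution `∏ i, μ i`. -/
def gridMass {n d : ℕ} (μ : Fin d → Fin n → ℝ) (x : Grid n d) : ℝ := ∏ i, μ i (x i)

/-- The `L_1` distance `∑ x, |f x - g x|` of `f` from a set `P` of functions
(the infimum over `g ∈ P`). -/
noncomputable def l1Dist {α : Type*} [Fintype α] (f : α → ℝ) (P : Set (α → ℝ)) : ℝ :=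
  sInf ((fun g : α → ℝ => ∑ x, |f x - g x|) '' P)

/-- The `L_1` distance of `f` from `P` with respect to the weights `w`:
the infimum of `∑ x, w x * |f x - g x|` over `g ∈ P`. -/
noncomputable def weightedL1Dist {α : Type*} [Fintype α] (w : α → ℝ) (f : α → ℝ)
    (P : Set (α → ℝ)) : ℝ :=
  sInf ((fun g : α → ℝ => ∑ x, w x * |f x - g x|) '' P)

/-! Fix positive weights. The functions on `[n]` obeying the bounds of one direction form a closed
convex sublattice, invariant under adding constants. Least-squares projection `A` onto it is
therefore monotone, commutes with constants and keeps weighted sums. Monotonicity and sum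
preservation make `A` an `L_1` contraction (`sum_mul_abs_sub_le_of_monotone`). Monotonicity and
translation keep every bound on the difference of two parallel lines (`le_apply_sub_apply`,
`apply_sub_apply_le`), so repairing one direction spoils no other.

Repair the directions one by one. If `k` satisfies direction `a`, the repair `T` fixes `k`, so `F`
moves by at most `N F k + N (T k) (T F) ≤ 2 * N F k`. The contraction also ensures that earlier
repairs have not increased the available bound on `N F k`. Summing over directions gives the factor
2. Limits remove the positivity of the weights and the choice of near-optimal line functions. -/

/-! ### Least-squares projection onto a convex sublattice -/

section Projection

variable {ι : Type*} [Fintype ι]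

/-- `g` is a weighted least-squares projection of `f` to `P`. -/
def IsLeastSquares (w : ι → ℝ) (P : Set (ι → ℝ)) (f g : ι → ℝ) : Prop :=
  g ∈ P ∧ ∀ k ∈ P, ∑ i, w i * (f i - g i) ^ 2 ≤ ∑ i, w i * (f i - k i) ^ 2

theorem exists_isLeastSquares {w : ι → ℝ} (hw : ∀ i, 0 < w i) {P : Set (ι → ℝ)}
    (hc : IsClosed P) (hne : P.Nonempty) (f : ι → ℝ) : ∃ g, IsLeastSquares w P f g := by
  obtain ⟨g₀, hg₀⟩ := hne
  set Φ : (ι → ℝ) → ℝ := fun g => ∑ i, w i * (f i - g i) ^ 2 with hΦ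
  have hcont : Continuous Φ := by fun_prop
  have hKc : IsClosed (P ∩ {g | Φ g ≤ Φ g₀}) := hc.inter (isClosed_le hcont continuous_const)
  have hsub : P ∩ {g | Φ g ≤ Φ g₀} ⊆
      Set.Icc (fun i => f i - (Φ g₀ / w i + 1)) (fun i => f i + (Φ g₀ / w i + 1)) := by
    rintro g ⟨-, hg⟩
    have key : ∀ i, |f i - g i| ≤ Φ g₀ / w i + 1 := by
      intro i
      have h1 : w i * (f i - g i) ^ 2 ≤ Φ g₀ :=
        (Finset.single_le_sum (f := fun i => w i * (f i - g i) ^ 2)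
          (fun j _ => mul_nonneg (hw j).le (sq_nonneg _)) (Finset.mem_univ i)).trans hg
      have h2 : (f i - g i) ^ 2 ≤ Φ g₀ / w i := by
        rw [le_div_iff₀ (hw i)]; linarith
      rw [← sq_abs] at h2
      -- The `+ 1` avoids a square root: `u ^ 2 ≤ c` gives `u ≤ c + 1`.
      nlinarith [sq_nonneg (|f i - g i| - 1), abs_nonneg (f i - g i)]
    constructor <;> intro i <;> have := abs_le.1 (key i) <;> simp only <;> linarith
  obtain ⟨g, ⟨hgP, hg⟩, hmin⟩ := (isCompact_Icc.of_isClosed_subset hKc hsub).exists_isMinOn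
    ⟨g₀, hg₀, show Φ g₀ ≤ Φ g₀ from le_rfl⟩ hcont.continuousOn
  refine ⟨g, hgP, fun k hk => ?_⟩
  by_cases h : Φ k ≤ Φ g₀
  · exact hmin ⟨hk, h⟩
  · exact le_trans hg (not_le.1 h).le

/-- Strict convexity: by the parallelogram identity, the midpoint of two distinct minimizers would
do strictly better. -/
theorem IsLeastSquares.eq_of_le {w : ι → ℝ} (hw : ∀ i, 0 < w i) {P : Set (ι → ℝ)}
    (hmid : ∀ g ∈ P, ∀ k ∈ P, (fun i => (g i + k i) / 2) ∈ P) {f g k : ι → ℝ}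
    (hg : IsLeastSquares w P f g) (hk : k ∈ P)
    (hle : ∑ i, w i * (f i - k i) ^ 2 ≤ ∑ i, w i * (f i - g i) ^ 2) : g = k := by
  have h1 := hg.2 _ (hmid g hg.1 k hk)
  have h2 : ∑ i, w i * (f i - (g i + k i) / 2) ^ 2 + ∑ i, w i * ((g i - k i) ^ 2 / 4)
      = (∑ i, w i * (f i - g i) ^ 2 + ∑ i, w i * (f i - k i) ^ 2) / 2 := by
    rw [← Finset.sum_add_distrib, ← Finset.sum_add_distrib, Finset.sum_div]
    exact Finset.sum_congr rfl fun i _ => by ring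
  have h3 : ∀ i ∈ Finset.univ, 0 ≤ w i * ((g i - k i) ^ 2 / 4) :=
    fun i _ => mul_nonneg (hw i).le (by positivity)
  have h4 : ∑ i, w i * ((g i - k i) ^ 2 / 4) = 0 :=
    le_antisymm (by linarith) (Finset.sum_nonneg h3)
  funext i
  have h5 := (Finset.sum_eq_zero_iff_of_nonneg h3).1 h4 i (Finset.mem_univ i)
  rcases mul_eq_zero.1 h5 with h | h
  · exact absurd h (hw i).ne'
  · have : g i - k i = 0 := by
      rw [← sq_eq_zero_iff]; linarith
    linarith

/-- Exchange argument: as `f ≤ f'`, replacing the pair `g, g'` by `g ⊓ g', g ⊔ g'` does not raise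
the total cost. Optimality of `g'` then makes `g ⊓ g'` as good as `g`, and uniqueness gives `g = g ⊓
g'`. -/
theorem IsLeastSquares.mono {w : ι → ℝ} (hw : ∀ i, 0 < w i) {P : Set (ι → ℝ)}
    (hmid : ∀ g ∈ P, ∀ k ∈ P, (fun i => (g i + k i) / 2) ∈ P)
    (hinf : ∀ g ∈ P, ∀ k ∈ P, g ⊓ k ∈ P) (hsup : ∀ g ∈ P, ∀ k ∈ P, g ⊔ k ∈ P)
    {f f' g g' : ι → ℝ} (hg : IsLeastSquares w P f g) (hg' : IsLeastSquares w P f' g')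
    (hff : f ≤ f') : g ≤ g' := by
  have h1 := hg'.2 _ (hsup g hg.1 g' hg'.1)
  have h2 : ∑ i, w i * (f i - (g ⊓ g') i) ^ 2 + ∑ i, w i * (f' i - (g ⊔ g') i) ^ 2
      ≤ ∑ i, w i * (f i - g i) ^ 2 + ∑ i, w i * (f' i - g' i) ^ 2 := by
    rw [← Finset.sum_add_distrib, ← Finset.sum_add_distrib]
    refine Finset.sum_le_sum fun i _ => ?_
    rw [← mul_add, ← mul_add]
    refine mul_le_mul_of_nonneg_left ?_ (hw i).le
    have := hff i
    rcases le_total (g i) (g' i) with h | h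
    · simp [h]
    · simp only [Pi.inf_apply, Pi.sup_apply, inf_of_le_right h, sup_of_le_left h]
      nlinarith [mul_nonneg (sub_nonneg.2 this) (sub_nonneg.2 h)]
  have h3 := hg.eq_of_le hw hmid (hinf g hg.1 g' hg'.1) (by linarith)
  rw [h3]
  exact inf_le_right

/-- A closed convex sublattice of `ι → ℝ` that is invariant under adding constants admits a
retraction that is monotone, commutes with adding constants and preserves weighted sums. -/
theorem exists_monotone_retraction {w : ι → ℝ} (hw : ∀ i, 0 < w i) {P : Set (ι → ℝ)}
    (hc : IsClosed P) (hne : P.Nonempty)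
    (hmid : ∀ g ∈ P, ∀ k ∈ P, (fun i => (g i + k i) / 2) ∈ P)
    (hinf : ∀ g ∈ P, ∀ k ∈ P, g ⊓ k ∈ P) (hsup : ∀ g ∈ P, ∀ k ∈ P, g ⊔ k ∈ P)
    (hadd : ∀ g ∈ P, ∀ c : ℝ, (fun i => g i + c) ∈ P) :
    ∃ A : (ι → ℝ) → (ι → ℝ), (∀ f, A f ∈ P) ∧ (∀ f ∈ P, A f = f) ∧ Monotone A ∧
      (∀ f (c : ℝ), A (fun i => f i + c) = fun i => A f i + c) ∧
      ∀ f, ∑ i, w i * A f i = ∑ i, w i * f i := by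
  choose A hA using exists_isLeastSquares hw hc hne
  refine ⟨A, fun f => (hA f).1, fun f hf => ?_, fun f f' h => ?_, fun f c => ?_, fun f => ?_⟩
  · refine (hA f).eq_of_le hw hmid hf ?_
    simpa using Finset.sum_nonneg fun i _ => mul_nonneg (hw i).le (sq_nonneg (f i - A f i))
  · exact (hA f).mono hw hmid hinf hsup (hA f') h
  · refine (hA _).eq_of_le hw hmid (hadd _ (hA f).1 c) ?_
    have := (hA f).2 _ (hadd _ (hA (fun i => f i + c)).1 (-c))
    refine le_trans (le_of_eq ?_) (this.trans (le_of_eq ?_)) <;>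
      exact Finset.sum_congr rfl fun i _ => by ring
  · set S := ∑ i, w i * (f i - A f i) with hS
    set W := ∑ i, w i with hW
    have hW0 : 0 ≤ W := Finset.sum_nonneg fun i _ => (hw i).le
    have h0 : S = 0 := by
      -- Compare `A f` with its shift by `t`. The best shift is `S / W`; the denominator `W + 1` is
      -- nonzero even when `ι` is empty, and still forces `t = 0`.
      set t := S / (W + 1) with ht
      have hSt : S = t * (W + 1) := by rw [ht]; field_simp
      have h1 := (hA f).2 _ (hadd _ (hA f).1 t)
      have h2 : ∑ i, w i * (f i - (A f i + t)) ^ 2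
          = ∑ i, w i * (f i - A f i) ^ 2 - 2 * t * S + t ^ 2 * W := by
        rw [hS, hW, Finset.mul_sum, Finset.mul_sum, ← Finset.sum_sub_distrib,
          ← Finset.sum_add_distrib]
        exact Finset.sum_congr rfl fun i _ => by ring
      have h3 : t ^ 2 * (W + 2) ≤ 0 := by
        have hts : t * S = t * (t * (W + 1)) := congrArg (t * ·) hSt
        rw [h2] at h1
        linarith
      have h4 : t ^ 2 = 0 := by nlinarith [sq_nonneg t, mul_nonneg (sq_nonneg t) hW0]
      rw [hSt, pow_eq_zero_iff two_ne_zero |>.1 h4, zero_mul]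
    simp only [hS, mul_sub, Finset.sum_sub_distrib] at h0
    linarith

/-- A monotone map that preserves weighted sums is nonexpansive in the weighted `L_1` norm. -/
theorem sum_mul_abs_sub_le_of_monotone {w : ι → ℝ} (hw : ∀ i, 0 ≤ w i)
    {A : (ι → ℝ) → (ι → ℝ)} (hA : Monotone A) (hsum : ∀ f, ∑ i, w i * A f i = ∑ i, w i * f i)
    (f g : ι → ℝ) : ∑ i, w i * |A f i - A g i| ≤ ∑ i, w i * |f i - g i| := by
  have hf : A f ≤ A (f ⊔ g) := hA le_sup_left
  have hg : A g ≤ A (f ⊔ g) := hA le_sup_right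
  -- `A (f ⊔ g)` dominates both images, which bounds the left side by an expression linear in
  -- `A`-values. Sum preservation removes `A`, and for `f ⊔ g` itself the bound is an equality.
  calc ∑ i, w i * |A f i - A g i|
      ≤ ∑ i, (2 * (w i * A (f ⊔ g) i) - w i * A f i - w i * A g i) := by
        refine Finset.sum_le_sum fun i _ => ?_
        have h : |A f i - A g i| ≤ 2 * A (f ⊔ g) i - A f i - A g i :=
          abs_le.2 ⟨by linarith [hf i, hg i], by linarith [hf i, hg i]⟩
        linarith [mul_le_mul_of_nonneg_left h (hw i)]
    _ = ∑ i, (2 * (w i * (f ⊔ g) i) - w i * f i - w i * g i) := by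
        simp only [Finset.sum_sub_distrib, ← Finset.mul_sum, hsum]
    _ = ∑ i, w i * |f i - g i| := by
        refine Finset.sum_congr rfl fun i _ => ?_
        rcases le_total (f i) (g i) with h | h
        · rw [Pi.sup_apply, sup_of_le_right h, abs_of_nonpos (by linarith)]; ring
        · rw [Pi.sup_apply, sup_of_le_left h, abs_of_nonneg (by linarith)]; ring

/-- With `c` the least value of `g - f`, one has `f + c ≤ g`, hence `A f + c ≤ A g`. Working with
the attained minimum keeps `c` real even if `a` is infinite. -/
theorem le_apply_sub_apply {A : (ι → ℝ) → (ι → ℝ)} (hA : Monotone A)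
    (hc : ∀ f (c : ℝ), A (fun i => f i + c) = fun i => A f i + c) {a : EReal} {f g : ι → ℝ}
    (h : ∀ i, a ≤ ((g i - f i : ℝ) : EReal)) (i : ι) : a ≤ ((A g i - A f i : ℝ) : EReal) := by
  have : Nonempty ι := ⟨i⟩
  obtain ⟨j, hj⟩ := Finite.exists_min fun i => g i - f i
  refine (h j).trans (EReal.coe_le_coe_iff.2 ?_)
  have h1 : (fun k => f k + (g j - f j)) ≤ g := fun k => by have := hj k; simp only; linarith
  have h2 := hA h1 i
  rw [hc] at h2
  simp only at h2
  linarith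

theorem apply_sub_apply_le {A : (ι → ℝ) → (ι → ℝ)} (hA : Monotone A)
    (hc : ∀ f (c : ℝ), A (fun i => f i + c) = fun i => A f i + c) {b : EReal} {f g : ι → ℝ}
    (h : ∀ i, ((g i - f i : ℝ) : EReal) ≤ b) (i : ι) : ((A g i - A f i : ℝ) : EReal) ≤ b := by
  have : Nonempty ι := ⟨i⟩
  obtain ⟨j, hj⟩ := Finite.exists_max fun i => g i - f i
  refine le_trans (EReal.coe_le_coe_iff.2 ?_) (h j)
  have h1 : g ≤ (fun k => f k + (g j - f j)) := fun k => by have := hj k; simp only; linarith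
  have h2 := hA h1 i
  rw [hc] at h2
  simp only at h2
  linarith

end Projection

/-! ### Constraints along one direction and their repair -/

namespace BoundingFamily

variable {n d : ℕ} (B : BoundingFamily n d) (r : Fin d)

theorem lineProperty_nonempty : (B.lineProperty r).Nonempty := by
  choose c hc using fun t => EReal.lt_iff_exists_real_btwn.1 (B.lower_lt_upper r t)
  -- Partial sums of slopes chosen strictly between the bounds; the default `0` is never reached,
  -- since `s < t ≤ n - 1`.
  refine ⟨fun t => ∑ s ∈ Finset.range t, if h : s < n - 1 then c ⟨s, h⟩ else 0, fun t h => ?_⟩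
  have ht : (t : ℕ) < n - 1 := by omega
  simp only [Finset.sum_range_succ, dif_pos ht, add_sub_cancel_left]
  exact ⟨(hc _).1.le, (hc _).2.le⟩

theorem isClosed_lineProperty : IsClosed (B.lineProperty r) := by
  simp only [lineProperty, Set.ofPred_forall, Set.ofPred_and]
  refine isClosed_iInter fun t => isClosed_iInter fun h => ?_
  have hcont : Continuous fun g : Fin n → ℝ => ((g ⟨(t : ℕ) + 1, h⟩ - g t : ℝ) : EReal) :=
    continuous_coe_real_ereal.comp (by fun_prop)
  exact (isClosed_le continuous_const hcont).inter (isClosed_le hcont continuous_const)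

/-- A single test that covers midpoints, meets, joins and translates: their increments lie between
those of `g` and `k`. -/
theorem mem_lineProperty_of_between {r} {g k m : Fin n → ℝ} (hg : g ∈ B.lineProperty r)
    (hk : k ∈ B.lineProperty r)
    (hm : ∀ s t, min (g s - g t) (k s - k t) ≤ m s - m t ∧
      m s - m t ≤ max (g s - g t) (k s - k t)) : m ∈ B.lineProperty r := by
  intro t h
  obtain ⟨h1, h2⟩ := hm ⟨(t : ℕ) + 1, h⟩ t
  constructor
  · rcases min_le_iff.1 h1 with h | h
    · exact (hg t _).1.trans (EReal.coe_le_coe_iff.2 h)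
    · exact (hk t _).1.trans (EReal.coe_le_coe_iff.2 h)
  · rcases le_max_iff.1 h2 with h | h
    · exact (EReal.coe_le_coe_iff.2 h).trans (hg t _).2
    · exact (EReal.coe_le_coe_iff.2 h).trans (hk t _).2

theorem exists_retraction_lineProperty {w : Fin n → ℝ} (hw : ∀ t, 0 < w t) :
    ∃ A : (Fin n → ℝ) → (Fin n → ℝ), (∀ f, A f ∈ B.lineProperty r) ∧
      (∀ f ∈ B.lineProperty r, A f = f) ∧ Monotone A ∧
      (∀ f (c : ℝ), A (fun i => f i + c) = fun i => A f i + c) ∧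
      ∀ f, ∑ i, w i * A f i = ∑ i, w i * f i := by
  refine exists_monotone_retraction hw (B.isClosed_lineProperty r) (B.lineProperty_nonempty r)
    (fun g hg k hk => ?_) (fun g hg k hk => ?_) (fun g hg k hk => ?_) (fun g hg c => ?_)
  · refine B.mem_lineProperty_of_between hg hk fun s t => ?_
    grind
  · refine B.mem_lineProperty_of_between hg hk fun s t => ?_
    simp only [Pi.inf_apply]
    grind
  · refine B.mem_lineProperty_of_between hg hk fun s t => ?_
    simp only [Pi.sup_apply]
    grind
  · exact B.mem_lineProperty_of_between hg hg fun s t => by simp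

/-- The functions on the grid that satisfy the constraints along dimension `r`. -/
def dirProperty : Set (Grid n d → ℝ) :=
  {f | ∀ x : Grid n d, (fun t => f (Function.update x r t)) ∈ B.lineProperty r}

variable {B}

theorem mem_property_of_forall_mem_dirProperty {f : Grid n d → ℝ}
    (hf : ∀ r, f ∈ B.dirProperty r) : f ∈ B.property := by
  intro r x h
  have := hf r x (x r) h
  simpa only [Function.update_eq_self] using this

/-- A line operator applied to all lines along dimension `r`. -/
def alongDir (r : Fin d) (A : (Fin n → ℝ) → (Fin n → ℝ)) (f : Grid n d → ℝ) : Grid n d → ℝ :=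
  fun x => A (fun t => f (Function.update x r t)) (x r)

variable {r}

theorem alongDir_mem_dirProperty {A : (Fin n → ℝ) → (Fin n → ℝ)}
    (hA : ∀ f, A f ∈ B.lineProperty r) (f : Grid n d → ℝ) :
    alongDir r A f ∈ B.dirProperty r := by
  intro x
  simpa [alongDir] using hA _

theorem alongDir_eq_self {A : (Fin n → ℝ) → (Fin n → ℝ)}
    (hA : ∀ f ∈ B.lineProperty r, A f = f) {f : Grid n d → ℝ} (hf : f ∈ B.dirProperty r) :
    alongDir r A f = f := by
  funext x
  simp [alongDir, hA _ (hf x)]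

/-- An `s`-edge joins corresponding points of two parallel `r`-lines, whose difference is bounded
uniformly; `A` keeps such bounds. -/
theorem alongDir_mem_dirProperty_of_ne {A : (Fin n → ℝ) → (Fin n → ℝ)} (hA : Monotone A)
    (hc : ∀ f (c : ℝ), A (fun i => f i + c) = fun i => A f i + c) {s : Fin d} (hs : s ≠ r)
    {f : Grid n d → ℝ} (hf : f ∈ B.dirProperty s) : alongDir r A f ∈ B.dirProperty s := by
  intro x t h
  simp only [alongDir, Function.update_of_ne hs.symm]
  have key : ∀ i, B.lower s ⟨t, by omega⟩ ≤
        ((f (Function.update (Function.update x s ⟨(t : ℕ) + 1, h⟩) r i) -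
          f (Function.update (Function.update x s t) r i) : ℝ) : EReal) ∧
      ((f (Function.update (Function.update x s ⟨(t : ℕ) + 1, h⟩) r i) -
          f (Function.update (Function.update x s t) r i) : ℝ) : EReal)
        ≤ B.upper s ⟨t, by omega⟩ := by
    intro i
    rw [Function.update_comm hs, Function.update_comm hs]
    exact hf (Function.update x r i) t h
  exact ⟨le_apply_sub_apply hA hc (fun i => (key i).1) _,
    apply_sub_apply_le hA hc (fun i => (key i).2) _⟩

end BoundingFamily

/-! ### Decomposition into lines, and the distance estimate -/

section Lines

variable {n d : ℕ}

theorem AxisLine.update_point (l : AxisLine n d) (s t : Fin n) :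
    Function.update (l.point s) l.dir t = l.point t := by
  funext j
  by_cases h : j = l.1
  · subst h; simp [AxisLine.point, AxisLine.dir]
  · simp [AxisLine.point, AxisLine.dir, h]

theorem AxisLine.point_dir (l : AxisLine n d) (t : Fin n) : l.point t l.dir = t := by
  simp [AxisLine.point, AxisLine.dir]

theorem gridMass_point (μ : Fin d → Fin n → ℝ) (l : AxisLine n d) (t : Fin n) :
    gridMass μ (l.point t) = l.mass μ * μ l.dir t := by
  rw [gridMass, Fintype.prod_eq_mul_prod_subtype_ne _ l.dir, l.point_dir, mul_comm]
  congr 1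
  refine Finset.prod_congr rfl fun j _ => ?_
  simp only [AxisLine.point, dif_neg (show j.1 ≠ l.1 from j.2)]
  rfl

theorem sum_grid_eq_sum_lines (i : Fin d) (F : Grid n d → ℝ) :
    ∑ x, F x = ∑ q : {j : Fin d // j ≠ i} → Fin n, ∑ t, F (AxisLine.point ⟨i, q⟩ t) := by
  rw [← (Equiv.funSplitAt i (Fin n)).symm.sum_comp, Fintype.sum_prod_type, Finset.sum_comm]
  refine Finset.sum_congr rfl fun q _ => Finset.sum_congr rfl fun t _ => congrArg F ?_
  funext j
  simp [AxisLine.point, Equiv.funSplitAt]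

theorem sum_gridMass_mul_eq (μ : Fin d → Fin n → ℝ) (i : Fin d) (F : Grid n d → ℝ) :
    ∑ x, gridMass μ x * F x = ∑ q : {j : Fin d // j ≠ i} → Fin n,
      AxisLine.mass ⟨i, q⟩ μ * ∑ t, μ i t * F (AxisLine.point ⟨i, q⟩ t) := by
  rw [sum_grid_eq_sum_lines i]
  refine Finset.sum_congr rfl fun q _ => ?_
  rw [Finset.mul_sum]
  refine Finset.sum_congr rfl fun t _ => ?_
  rw [gridMass_point, mul_assoc]
  rfl

theorem AxisLine.mass_nonneg {μ : Fin d → Fin n → ℝ} (hμ : ∀ i t, 0 ≤ μ i t)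
    (l : AxisLine n d) : 0 ≤ l.mass μ :=
  Finset.prod_nonneg fun _ _ => hμ _ _

theorem gridMass_nonneg {μ : Fin d → Fin n → ℝ} (hμ : ∀ i t, 0 ≤ μ i t) (x : Grid n d) :
    0 ≤ gridMass μ x :=
  Finset.prod_nonneg fun _ _ => hμ _ _

theorem sum_abs_alongDir_sub_le {μ : Fin d → Fin n → ℝ} (hμ : ∀ i t, 0 ≤ μ i t) (i : Fin d)
    {A : (Fin n → ℝ) → (Fin n → ℝ)}
    (hA : ∀ f g, ∑ t, μ i t * |A f t - A g t| ≤ ∑ t, μ i t * |f t - g t|)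
    (f g : Grid n d → ℝ) :
    ∑ x, gridMass μ x * |BoundingFamily.alongDir i A f x - BoundingFamily.alongDir i A g x|
      ≤ ∑ x, gridMass μ x * |f x - g x| := by
  rw [sum_gridMass_mul_eq μ i, sum_gridMass_mul_eq μ i]
  refine Finset.sum_le_sum fun q _ =>
    mul_le_mul_of_nonneg_left ?_ (AxisLine.mass_nonneg hμ _)
  have h : ∀ (k : Grid n d → ℝ) t, BoundingFamily.alongDir i A k (AxisLine.point ⟨i, q⟩ t)
      = A (AxisLine.restrict ⟨i, q⟩ k) t := by
    intro k t
    have h1 := AxisLine.update_point ⟨i, q⟩ t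
    have h2 := AxisLine.point_dir ⟨i, q⟩ t
    simp only [AxisLine.dir] at h1 h2
    simp only [BoundingFamily.alongDir, h1, h2]
    rfl
  simp only [h]
  exact hA _ _

theorem exists_mem_property_of_pos (B : BoundingFamily n d) {μ : Fin d → Fin n → ℝ}
    (hμ : ∀ i t, 0 < μ i t) (f : Grid n d → ℝ) (g : Fin d → Grid n d → ℝ)
    (hg : ∀ i, g i ∈ B.dirProperty i) :
    ∃ F ∈ B.property, ∑ x, gridMass μ x * |f x - F x|
      ≤ 2 * ∑ i, ∑ x, gridMass μ x * |f x - g i x| := by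
  have hμ0 : ∀ i t, 0 ≤ μ i t := fun i t => (hμ i t).le
  set N : (Grid n d → ℝ) → (Grid n d → ℝ) → ℝ :=
    fun f g => ∑ x, gridMass μ x * |f x - g x| with hN
  have htri : ∀ a b c, N a c ≤ N a b + N b c := by
    intro a b c
    simp only [hN, ← Finset.sum_add_distrib, ← mul_add]
    exact Finset.sum_le_sum fun x _ =>
      mul_le_mul_of_nonneg_left (abs_sub_le _ _ _) (gridMass_nonneg hμ0 x)
  have hcomm : ∀ a b, N a b = N b a := fun a b => by simp only [hN, abs_sub_comm]
  -- Induction over the directions already repaired. The last clause carries the argument: `F` is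
  -- still as close to each direction's constraint set as the bound `N f (g j)` for the original
  -- `f`.
  have key : ∀ s : Finset (Fin d), ∃ F, (∀ i ∈ s, F ∈ B.dirProperty i) ∧
      N f F ≤ 2 * ∑ i ∈ s, N f (g i) ∧ ∀ j, ∃ k ∈ B.dirProperty j, N F k ≤ N f (g j) := by
    intro s
    induction s using Finset.induction_on with
    | empty => exact ⟨f, by simp, by simp [hN], fun j => ⟨g j, hg j, le_refl _⟩⟩
    | insert a s ha ih =>
      obtain ⟨F, hF, hle, hk⟩ := ih
      obtain ⟨A, hmem, hfix, hmono, hadd, hsum⟩ := B.exists_retraction_lineProperty a (hμ a)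
      set T := BoundingFamily.alongDir a A
      have hT : ∀ p q, N (T p) (T q) ≤ N p q := sum_abs_alongDir_sub_le hμ0 a
        (sum_mul_abs_sub_le_of_monotone (hμ0 a) hmono hsum)
      have hpres : ∀ j, ∀ k ∈ B.dirProperty j, T k ∈ B.dirProperty j := by
        intro j k hk
        by_cases h : j = a
        · subst h; exact BoundingFamily.alongDir_mem_dirProperty hmem k
        · exact BoundingFamily.alongDir_mem_dirProperty_of_ne hmono hadd h hk
      refine ⟨T F, fun i hi => ?_, ?_, fun j => ?_⟩
      · rcases Finset.mem_insert.1 hi with rfl | hi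
        · exact BoundingFamily.alongDir_mem_dirProperty hmem F
        · exact hpres i F (hF i hi)
      · obtain ⟨k, hka, hkle⟩ := hk a
        have h1 := hT k F
        -- Since `T` fixes `k`, contraction gives `N k (T F) ≤ N F k`; the path from `F` through `k`
        -- to `T F` costs at most twice `N F k`.
        rw [show T k = k from BoundingFamily.alongDir_eq_self hfix hka, hcomm k F] at h1
        rw [Finset.sum_insert ha]
        linarith [htri f F (T F), htri F k (T F)]
      · obtain ⟨k, hkj, hkle⟩ := hk j
        exact ⟨T k, hpres j k hkj, (hT F k).trans hkle⟩
  obtain ⟨F, hF, hle, -⟩ := key Finset.univ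
  exact ⟨F, BoundingFamily.mem_property_of_forall_mem_dirProperty
    fun r => hF r (Finset.mem_univ r), hle⟩

theorem weightedL1Dist_le {α : Type*} [Fintype α] {w : α → ℝ} (hw : ∀ x, 0 ≤ w x)
    (f : α → ℝ) {P : Set (α → ℝ)} {g : α → ℝ} (hg : g ∈ P) :
    weightedL1Dist w f P ≤ ∑ x, w x * |f x - g x| := by
  refine csInf_le ⟨0, ?_⟩ ⟨g, hg, rfl⟩
  rintro _ ⟨k, -, rfl⟩
  exact Finset.sum_nonneg fun x _ => mul_nonneg (hw x) (abs_nonneg _)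

/-- Zero weights would break uniqueness of the projection. Adding `δ > 0` to every weight restores
positivity and only increases the mass of each point; then `δ → 0`. -/
theorem weightedL1Dist_le_two_mul_sum (B : BoundingFamily n d) {μ : Fin d → Fin n → ℝ}
    (hμ : ∀ i t, 0 ≤ μ i t) (f : Grid n d → ℝ) (g : Fin d → Grid n d → ℝ)
    (hg : ∀ i, g i ∈ B.dirProperty i) :
    weightedL1Dist (gridMass μ) f B.property
      ≤ 2 * ∑ i, ∑ x, gridMass μ x * |f x - g i x| := by
  set R : ℝ → ℝ := fun δ => 2 * ∑ i, ∑ x, gridMass (fun i t => μ i t + δ) x * |f x - g i x|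
    with hR
  have hcont : Continuous R := by
    simp only [hR, gridMass]
    fun_prop
  have hlim : Filter.Tendsto R (nhdsWithin 0 (Set.Ioi 0)) (nhds (R 0)) :=
    hcont.continuousAt.tendsto.mono_left nhdsWithin_le_nhds
  have hR0 : R 0 = 2 * ∑ i, ∑ x, gridMass μ x * |f x - g i x| := by simp [hR]
  rw [← hR0]
  refine ge_of_tendsto hlim ?_
  filter_upwards [self_mem_nhdsWithin] with δ hδ
  have hδ : 0 < δ := hδ
  obtain ⟨F, hF, hle⟩ := exists_mem_property_of_pos B (μ := fun i t => μ i t + δ)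
    (fun i t => by linarith [hμ i t]) f g hg
  refine (weightedL1Dist_le (gridMass_nonneg hμ) f hF).trans (le_trans ?_ hle)
  refine Finset.sum_le_sum fun x _ => mul_le_mul_of_nonneg_right ?_ (abs_nonneg _)
  exact Finset.prod_le_prod (fun i _ => hμ _ _) fun i _ => by linarith

theorem weightedL1Dist_div_two_le (B : BoundingFamily n d) {μ : Fin d → Fin n → ℝ}
    (hμ : ∀ i t, 0 ≤ μ i t) (f : Grid n d → ℝ) :
    weightedL1Dist (gridMass μ) f B.property / 2
      ≤ ∑ l : AxisLine n d,
          l.mass μ * weightedL1Dist (μ l.dir) (l.restrict f) (B.lineProperty l.dir) := by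
  set R : ℝ → ℝ := fun ε => ∑ l : AxisLine n d,
    l.mass μ * (weightedL1Dist (μ l.dir) (l.restrict f) (B.lineProperty l.dir) + ε) with hR
  have hcont : Continuous R := by fun_prop
  have hlim : Filter.Tendsto R (nhdsWithin 0 (Set.Ioi 0)) (nhds (R 0)) :=
    hcont.continuousAt.tendsto.mono_left nhdsWithin_le_nhds
  have hR0 : R 0 = ∑ l : AxisLine n d,
      l.mass μ * weightedL1Dist (μ l.dir) (l.restrict f) (B.lineProperty l.dir) := by simp [hR]
  rw [← hR0]
  refine ge_of_tendsto hlim ?_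
  filter_upwards [self_mem_nhdsWithin] with ε hε
  have hε : 0 < ε := hε
  have hnear : ∀ l : AxisLine n d, ∃ h ∈ B.lineProperty l.dir,
      ∑ t, μ l.dir t * |l.restrict f t - h t|
        < weightedL1Dist (μ l.dir) (l.restrict f) (B.lineProperty l.dir) + ε := by
    intro l
    obtain ⟨_, ⟨h, hh, rfl⟩, hlt⟩ := exists_lt_of_csInf_lt
      ((B.lineProperty_nonempty l.dir).image
        (fun h : Fin n → ℝ => ∑ t, μ l.dir t * |l.restrict f t - h t|))
      (lt_add_of_pos_right _ hε)
    exact ⟨h, hh, hlt⟩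
  choose h hmem hlt using hnear
  -- Glue the near-optimal functions: at `x`, the witness for direction `i` is the function chosen
  -- on the `i`-line through `x`.
  have hmain := weightedL1Dist_le_two_mul_sum B hμ f
    (fun i x => h ⟨i, fun j => x j.1⟩ (x i)) (fun i x => by
      have : ∀ t, (fun j : {j : Fin d // j ≠ i} => Function.update x i t j.1)
          = fun j => x j.1 := fun t => by
        funext j
        exact Function.update_of_ne j.2 _ _
      simp only [this, Function.update_self]
      exact hmem ⟨i, fun j => x j.1⟩)
  have hsum : ∑ i, ∑ x, gridMass μ x * |f x - h ⟨i, fun j => x j.1⟩ (x i)| ≤ R ε := by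
    simp only [hR, Fintype.sum_sigma]
    refine Finset.sum_le_sum fun i _ => ?_
    rw [sum_gridMass_mul_eq μ i]
    refine Finset.sum_le_sum fun q _ =>
      mul_le_mul_of_nonneg_left ?_ (AxisLine.mass_nonneg hμ _)
    refine le_trans (le_of_eq ?_) (hlt ⟨i, q⟩).le
    refine Finset.sum_congr rfl fun t _ => ?_
    have h1 : (fun j : {j : Fin d // j ≠ i} => AxisLine.point ⟨i, q⟩ t j.1) = q := by
      funext j
      simp [AxisLine.point, j.2]
    have h2 : AxisLine.point ⟨i, q⟩ t i = t := AxisLine.point_dir ⟨i, q⟩ t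
    rw [h1, h2]
    rfl
  linarith

end Lines

theorem mainTheorem3 (n d : ℕ) (B : BoundingFamily n d) (f : Grid n d → ℝ) :
    (l1Dist f B.property / 2
        ≤ ∑ l : AxisLine n d, l1Dist (l.restrict f) (B.lineProperty l.dir)) ∧
    (∀ μ : Fin d → Fin n → ℝ, (∀ i, μ i ∈ stdSimplex ℝ (Fin n)) →
      weightedL1Dist (gridMass μ) f B.property / 2
        ≤ ∑ l : AxisLine n d,
            l.mass μ * weightedL1Dist (μ l.dir) (l.restrict f) (B.lineProperty l.dir)) := by
  refine ⟨?_, fun μ hμ => weightedL1Dist_div_two_le B (fun i t => (hμ i).1 t) f⟩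
  -- The weighted bound needs only nonnegative weights, not total mass one, so constant weights `1`
  -- give the unweighted case.
  have h := weightedL1Dist_div_two_le B (μ := fun _ _ => 1) (fun _ _ => zero_le_one) f
  simpa only [weightedL1Dist, l1Dist, gridMass, AxisLine.mass, Finset.prod_const_one,
    one_mul] using h
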